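/- Let $\mathbb G$ be a compact quantum group with Hopf $*$-algebra $H=\mathcal O(\mathbb G)$ and comultiplication $\Delta$, counit $\varepsilon$ and antipode $S$; that is, $H$ is a Hopf algebra over $\mathbb C$ with a conjugate-linear involution making it a $*$-algebra, $\Delta$ is a $*$-homomorphism, and $H$ is the linear span of the matrix coefficients of its finite-dimensional unitary representations (unitary matrices $U=(u_{ij})\in M_n(H)$ with $\Delta(u_{ij})=\sum_k u_{ik}\otimes u_{kj}$). For each $x$ in the set $\mathrm{Irred}(\mathbb G)$ of equivalence classes of irreducible unitary representations choose a unitary representative $U^x=(u^x_{ij})$ on a Hilbert space $\mathcal H_x$ with orthonormal basis $(\xi^x_i)$; write $\varepsilon\in\mathrm{Irred}(\mathbb G)$ also for the class of the trivial representation. Let $\mathcal M(c_0(\hat{\mathbb G})\otimes c_0(\hat{\mathbb G}))$ be the $*$-algebra of bounded families in $\prod_{x,y}B(\mathcal H_x\otimes\mathcal H_y)$, and let $\hat\Delta$ be the dual comultiplication, determined by $(\hat\Delta\otimes\mathrm{id})(\mathbb V)=\mathbb V_{13}\mathbb V_{23}$ for $\mathbb V=\bigoplus_x U^x$. A unitary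 $2$-cocycle on $\hat{\mathbb G}$ is a unitary $\Omega\in\mathcal M(c_0(\hat{\mathbb G})\otimes c_0(\hat{\mathbb G}))$ with $$(\Omega\otimes1)(\hat\Delta\otimes\mathrm{id})(\Omega)=(1\otimes\Omega)(\mathrm{id}\otimes\hat\Delta)(\Omega).$$ It is normalized if its components in $B(\mathcal H_\varepsilon\otimes\mathcal H_y)$ and in $B(\mathcal H_x\otimes\mathcal H_\varepsilon)$ are the identity for all $x,y$. A unitary (algebraic) dual $2$-cocycle on $H$ is a linear map $\sigma:H\odot H\to\mathbb C$ with $$\sigma(a_{(1)},b_{(1)})\,\sigma(a_{(2)}b_{(2)},c)=\sigma(b_{(1)},c_{(1)})\,\sigma(a,b_{(2)}c_{(2)})\qquad(a,b,c\in H)$$ that has a convolution inverse $\sigma^{-1}$ satisfying $\overline{\sigma(a,b)}=\sigma^{-1}(S(a)^*,S(b)^*)$ for all $a,b\in H$. It is normalized if $\sigma(1,h)=\varepsilon(h)=\sigma(h,1)$ for all $h\in H$. Consider the formula $$\sigma(u^x_{ij}\otimes u^y_{kl})=\langle\xi^x_i\otimes\xi^y_k,\ \Omega(\xi^x_j\otimes\xi^y_l)\rangle\qquad\text{for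 all }x,y\in\mathrm{Irred}(\mathbb G)\text{ and all }i,j,k,l.\tag{1}$$ (a) If $\Omega$ is a unitary $2$-cocycle on $\hat{\mathbb G}$, there is exactly one linear map $\sigma:H\odot H\to\mathbb C$ satisfying (1); it is a unitary dual $2$-cocycle on $H$, and it is normalized if $\Omega$ is. (b) If $\sigma$ is a unitary dual $2$-cocycle on $H$, there is exactly one family $\Omega\in\prod_{x,y}B(\mathcal H_x\otimes\mathcal H_y)$ satisfying (1); it is a unitary $2$-cocycle on $\hat{\mathbb G}$ (in particular it is bounded), and it is normalized if $\sigma$ is. (c) Consequently (1) defines a bijection between the normalized unitary $2$-cocycles on $\hat{\mathbb G}$ and the normalized unitary dual $2$-cocycles on $\mathcal O(\mathbb G)$. -/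

import Mathlib

open scoped TensorProduct Matrix

set_option linter.unusedSectionVars false

namespace CQG

variable {H : Type*} [Ring H] [StarRing H] [HopfAlgebra ℂ H] [StarModule ℂ H]

/-! ### Finite-dimensional unitary representations, and compact quantum groups -/

/-- The operator `S ⊗ 1` attached to a scalar matrix `S`. -/
def scal (H : Type*) [Ring H] [Algebra ℂ H] {m n : Type*} (S : Matrix m n ℂ) : Matrix m n H :=
  S.map (algebraMap ℂ H)

/-- A finite-dimensional unitary representation, written as a matrix `U = (u_{ij})` in an
orthonormal basis: `U` is unitary and `(id ⊗ Δ) U = U₁₂ U₁₃`. -/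
def IsUnitaryRep {n : Type*} [Fintype n] [DecidableEq n] (U : Matrix n n H) : Prop :=
  U ∈ unitary (Matrix n n H) ∧
    ∀ i j, Coalgebra.comul (R := ℂ) (U i j) = ∑ k, U i k ⊗ₜ[ℂ] U k j

/-- The intertwiners `Mor(U, V) = {S | (S ⊗ 1) V = U (S ⊗ 1)}`. -/
def Mor {m n : Type*} [Fintype m] [Fintype n] (U : Matrix m m H) (V : Matrix n n H) :
    Set (Matrix m n ℂ) :=
  {S | scal H S * V = U * scal H S}

/-- Irreducibility: the space is nonzero and `Mor(U, U) = ℂ 1`. -/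
def IsIrreducible {n : Type*} [Fintype n] [DecidableEq n] (U : Matrix n n H) : Prop :=
  Nonempty n ∧ ∀ S ∈ Mor U U, ∃ c : ℂ, S = c • (1 : Matrix n n ℂ)

variable (H) in
/-- A compact quantum group `𝔾`, presented by its Hopf `*`-algebra `H = 𝒪(𝔾)`: the
comultiplication is a `*`-homomorphism, and `H` is the linear span of the matrix coefficients of
the finite-dimensional unitary representations. -/
class IsCompactQuantumGroup : Prop where
  comul_star : ∀ a : H, Coalgebra.comul (R := ℂ) (star a) = star (Coalgebra.comul (R := ℂ) a)
  span_coeff : Submodule.span ℂ {a : H | ∃ (n : ℕ) (U : Matrix (Fin n) (Fin n) H),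
    IsUnitaryRep U ∧ ∃ i j, a = U i j} = ⊤

variable (H) in
/-- An irreducible unitary representation of `𝔾` on some `ℂⁿ`. -/
structure IrrepMatrix where
  dim : ℕ
  mat : Matrix (Fin dim) (Fin dim) H
  isUnitaryRep : IsUnitaryRep mat
  isIrreducible : IsIrreducible mat

/-! ### Linear independence and spanning of matrix coefficients -/

theorem scal_mul {l m n : Type*} [Fintype m] (S : Matrix l m ℂ) (T : Matrix m n ℂ) :
    (scal H (S * T) : Matrix l n H) = scal H S * scal H T := by
  exact Matrix.map_mul

theorem scal_one {n : Type*} [DecidableEq n] : (scal H (1 : Matrix n n ℂ) : Matrix n n H) = 1 := by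
  simp [scal]

theorem scal_conjTranspose {m n : Type*} (S : Matrix m n ℂ) :
    (scal H Sᴴ : Matrix n m H) = (scal H S)ᴴ := by
  ext i j
  simp only [scal, Matrix.map_apply, Matrix.conjTranspose_apply, algebraMap_star_comm]

theorem mor_conjTranspose {m n : Type*} [Fintype m] [Fintype n] [DecidableEq m] [DecidableEq n]
    {U : Matrix m m H} {V : Matrix n n H} (hU : U ∈ unitary (Matrix m m H))
    (hV : V ∈ unitary (Matrix n n H)) {S : Matrix m n ℂ} (hS : S ∈ Mor U V) :
    Sᴴ ∈ Mor V U := by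
  have h : Vᴴ * scal H Sᴴ = (scal H Sᴴ : Matrix n m H) * Uᴴ := by
    have := congrArg Matrix.conjTranspose (show (scal H S : Matrix m n H) * V = U * scal H S from hS)
    rwa [Matrix.conjTranspose_mul, Matrix.conjTranspose_mul, ← scal_conjTranspose] at this
  have hV' : V * Vᴴ = 1 := (Unitary.mem_iff.1 hV).2
  have hU' : Uᴴ * U = 1 := (Unitary.mem_iff.1 hU).1
  show scal H Sᴴ * U = V * scal H Sᴴ
  calc (scal H Sᴴ : Matrix n m H) * U = V * Vᴴ * scal H Sᴴ * U := by rw [hV', Matrix.one_mul]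
    _ = V * (Vᴴ * scal H Sᴴ) * U := by rw [Matrix.mul_assoc V]
    _ = V * scal H Sᴴ * (Uᴴ * U) := by rw [h]; simp only [Matrix.mul_assoc]
    _ = _ := by rw [hU', Matrix.mul_one]

theorem mor_mul {l m n : Type*} [Fintype l] [Fintype m] [Fintype n]
    {U : Matrix l l H} {V : Matrix m m H} {W : Matrix n n H}
    {S : Matrix l m ℂ} {T : Matrix m n ℂ} (hS : S ∈ Mor U V) (hT : T ∈ Mor V W) :
    S * T ∈ Mor U W := by
  have hS' : (scal H S : Matrix l m H) * V = U * scal H S := hS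
  have hT' : (scal H T : Matrix m n H) * W = V * scal H T := hT
  show scal H (S * T) * W = U * scal H (S * T)
  rw [scal_mul, Matrix.mul_assoc, hT', ← Matrix.mul_assoc, hS', Matrix.mul_assoc]

theorem comul_iff {n : Type*} [Fintype n] (U : Matrix n n H) :
    (∀ i j, Coalgebra.comul (R := ℂ) (U i j) = ∑ k, U i k ⊗ₜ[ℂ] U k j) ↔
      U.map (Bialgebra.comulAlgHom ℂ H) =
        U.map (Algebra.TensorProduct.includeLeft : H →ₐ[ℂ] H ⊗[ℂ] H) *
          U.map (Algebra.TensorProduct.includeRight : H →ₐ[ℂ] H ⊗[ℂ] H) := by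
  rw [← Matrix.ext_iff]
  simp [Matrix.mul_apply]

theorem scal_map {K : Type*} [Ring K] [Algebra ℂ K] (f : H →ₐ[ℂ] K) {m n : Type*}
    (S : Matrix m n ℂ) : (scal H S).map f = scal K S := by
  ext i j
  simp [scal]

/-- Conjugating a unitary representation by a unitary scalar matrix. -/
theorem IsUnitaryRep.conj {m n : Type*} [Fintype n] [DecidableEq n] [Fintype m] [DecidableEq m]
    {U : Matrix n n H}
    (hU : IsUnitaryRep U) {V : Matrix n m ℂ} (hV : Vᴴ * V = 1) (hV' : V * Vᴴ = 1) :
    IsUnitaryRep (scal H Vᴴ * U * scal H V : Matrix m m H) := by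
  have h1 : (scal H Vᴴ : Matrix m n H) * scal H V = 1 := by rw [← scal_mul, hV, scal_one]
  have h2 : (scal H V : Matrix n m H) * scal H Vᴴ = 1 := by rw [← scal_mul, hV', scal_one]
  have hU1 : Uᴴ * U = 1 := (Unitary.mem_iff.1 hU.1).1
  have hU2 : U * Uᴴ = 1 := (Unitary.mem_iff.1 hU.1).2
  refine ⟨Unitary.mem_iff.2 ⟨?_, ?_⟩, ?_⟩
  · rw [Matrix.star_eq_conjTranspose, Matrix.conjTranspose_mul, Matrix.conjTranspose_mul,
      ← scal_conjTranspose, ← scal_conjTranspose, Matrix.conjTranspose_conjTranspose]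
    calc (scal H Vᴴ : Matrix m n H) * (Uᴴ * scal H V) * (scal H Vᴴ * U * scal H V)
        = scal H Vᴴ * (Uᴴ * ((scal H V * scal H Vᴴ) * U)) * scal H V := by simp only [Matrix.mul_assoc]
      _ = 1 := by rw [h2, Matrix.one_mul, hU1, Matrix.mul_one, h1]
  · rw [Matrix.star_eq_conjTranspose, Matrix.conjTranspose_mul, Matrix.conjTranspose_mul,
      ← scal_conjTranspose, ← scal_conjTranspose, Matrix.conjTranspose_conjTranspose]
    calc (scal H Vᴴ : Matrix m n H) * U * scal H V * (scal H Vᴴ * (Uᴴ * scal H V))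
        = scal H Vᴴ * (U * ((scal H V * scal H Vᴴ) * Uᴴ)) * scal H V := by simp only [Matrix.mul_assoc]
      _ = 1 := by rw [h2, Matrix.one_mul, hU2, Matrix.mul_one, h1]
  · rw [comul_iff]
    obtain ⟨-, hc⟩ := hU
    rw [comul_iff] at hc
    simp only [Matrix.map_mul, scal_map, hc]
    have h3 : (scal (H ⊗[ℂ] H) V : Matrix n m (H ⊗[ℂ] H)) * scal (H ⊗[ℂ] H) Vᴴ = 1 := by
      let f : H →ₐ[ℂ] H ⊗[ℂ] H := Algebra.TensorProduct.includeLeft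
      rw [← scal_map f, ← scal_map f, ← Matrix.map_mul, h2, Matrix.map_one _ (map_zero _) (map_one _)]
    calc _ = scal (H ⊗[ℂ] H) Vᴴ * U.map (Algebra.TensorProduct.includeLeft : H →ₐ[ℂ] H ⊗[ℂ] H) *
          ((scal (H ⊗[ℂ] H) V * scal (H ⊗[ℂ] H) Vᴴ) *
          U.map (Algebra.TensorProduct.includeRight : H →ₐ[ℂ] H ⊗[ℂ] H)) *
            scal (H ⊗[ℂ] H) V := by rw [h3, Matrix.one_mul]; simp only [Matrix.mul_assoc]
      _ = _ := by simp only [Matrix.mul_assoc]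

theorem sum_subtype_zero {n M : Type*} [Fintype n] [AddCommMonoid M] (p : n → Prop)
    [DecidablePred p] (f : n → M) (hf : ∀ k, ¬ p k → f k = 0) :
    ∑ k : {i // p i}, f k = ∑ k, f k := by
  rw [← Finset.sum_filter_of_ne (p := p) (fun k _ hk => by_contra fun h => hk (hf k h))]
  exact (Finset.sum_subtype _ (by simp) f).symm

theorem IsUnitaryRep.block {n : Type*} [Fintype n] [DecidableEq n] {U : Matrix n n H}
    (hU : IsUnitaryRep U) (p : n → Prop) [DecidablePred p]
    (h0 : ∀ i j, p i → ¬ p j → U i j = 0) (h1 : ∀ i j, ¬ p i → p j → U i j = 0) :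
    IsUnitaryRep (U.submatrix (Subtype.val : {i // p i} → n) Subtype.val) := by
  have hU1 : Uᴴ * U = 1 := (Unitary.mem_iff.1 hU.1).1
  have hU2 : U * Uᴴ = 1 := (Unitary.mem_iff.1 hU.1).2
  refine ⟨Unitary.mem_iff.2 ⟨?_, ?_⟩, ?_⟩
  · ext i j
    have := congrFun (congrFun hU1 i) j
    simp only [Matrix.mul_apply, Matrix.conjTranspose_apply, Matrix.one_apply,
      Matrix.star_eq_conjTranspose, Matrix.submatrix_apply, Subtype.ext_iff] at this ⊢
    rw [← this]
    exact sum_subtype_zero p (fun k => star (U k i) * U k j) fun k hk => by rw [h1 k j hk j.2, mul_zero]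
  · ext i j
    have := congrFun (congrFun hU2 i) j
    simp only [Matrix.mul_apply, Matrix.conjTranspose_apply, Matrix.one_apply,
      Matrix.star_eq_conjTranspose, Matrix.submatrix_apply, Subtype.ext_iff] at this ⊢
    rw [← this]
    exact sum_subtype_zero p (fun k => U i k * star (U j k)) fun k hk => by rw [h0 i k i.2 hk, zero_mul]
  · intro i j
    simp only [Matrix.submatrix_apply]
    rw [hU.2]
    exact (sum_subtype_zero p (fun k => U i k ⊗ₜ[ℂ] U k j) fun k hk => by
      rw [h0 i k i.2 hk, TensorProduct.zero_tmul]).symm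

theorem IsUnitaryRep.reindex {m n : Type*} [Fintype n] [DecidableEq n] [Fintype m] [DecidableEq m]
    {U : Matrix n n H} (hU : IsUnitaryRep U) (e : m ≃ n) : IsUnitaryRep (U.submatrix e e) := by
  refine ⟨Unitary.mem_iff.2 ⟨?_, ?_⟩, ?_⟩
  · have hU1 : Uᴴ * U = 1 := (Unitary.mem_iff.1 hU.1).1
    rw [Matrix.star_eq_conjTranspose, Matrix.conjTranspose_submatrix, Matrix.submatrix_mul_equiv,
      hU1, Matrix.submatrix_one_equiv]
  · have hU2 : U * Uᴴ = 1 := (Unitary.mem_iff.1 hU.1).2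
    rw [Matrix.star_eq_conjTranspose, Matrix.conjTranspose_submatrix, Matrix.submatrix_mul_equiv,
      hU2, Matrix.submatrix_one_equiv]
  · intro i j
    simp only [Matrix.submatrix_apply]
    rw [hU.2]
    exact (e.sum_comp fun k => U (e i) k ⊗ₜ[ℂ] U k (e j)).symm

/-- A non-irreducible one has a hermitian non-scalar self-intertwiner. -/
theorem exists_hermitian {n : Type*} [Fintype n] [DecidableEq n] {U : Matrix n n H}
    (hU : U ∈ unitary (Matrix n n H)) {S : Matrix n n ℂ} (hS : S ∈ Mor U U)
    (hs : ∀ c : ℂ, S ≠ c • (1 : Matrix n n ℂ)) :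
    ∃ T ∈ Mor U U, T.IsHermitian ∧ ∀ c : ℂ, T ≠ c • (1 : Matrix n n ℂ) := by
  have hS2 := mor_conjTranspose hU hU hS
  have hS' : scal H S * U = U * scal H S := hS
  have hS2' : scal H Sᴴ * U = U * scal H Sᴴ := hS2
  have add : ∀ A B : Matrix n n ℂ, scal H (A + B) = scal H A + scal H B := by
    intro A B; ext; simp [scal]
  have sm : ∀ (c : ℂ) (A : Matrix n n ℂ), scal H (c • A) = c • scal H A := by
    intro c A; ext i j
    simp only [scal, Matrix.map_apply, Matrix.smul_apply, smul_eq_mul, map_mul]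
    rw [Algebra.smul_def]
  have comb : ∀ c d : ℂ, c • S + d • Sᴴ ∈ Mor U U := by
    intro c d
    show scal H _ * U = U * scal H _
    rw [add, sm, sm, Matrix.add_mul, Matrix.mul_add, Matrix.smul_mul, Matrix.smul_mul, hS', hS2',
      Matrix.mul_smul, Matrix.mul_smul]
  by_cases h : ∃ c : ℂ, S + Sᴴ = c • (1 : Matrix n n ℂ)
  · obtain ⟨c, hc⟩ := h
    refine ⟨Complex.I • S + (-Complex.I) • Sᴴ, comb _ _, ?_, ?_⟩
    · rw [Matrix.IsHermitian, Matrix.conjTranspose_add, Matrix.conjTranspose_smul,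
        Matrix.conjTranspose_smul, Matrix.conjTranspose_conjTranspose, add_comm]
      simp
    · intro d hd
      apply hs ((1/2 : ℂ) * (c - Complex.I * d))
      have : S = (1/2 : ℂ) • ((S + Sᴴ) - Complex.I • (Complex.I • S + (-Complex.I) • Sᴴ)) := by
        ext i j
        simp only [Matrix.smul_apply, Matrix.add_apply, Matrix.sub_apply, smul_eq_mul]
        linear_combination (1/2 * (S i j) - 1/2 * (Sᴴ i j)) * (Complex.I_mul_I)
      rw [this, hc, hd, smul_smul, ← sub_smul, smul_smul]
  · refine ⟨S + Sᴴ, by simpa using comb 1 1, ?_, fun c hc => h ⟨c, hc⟩⟩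
    rw [Matrix.IsHermitian, Matrix.conjTranspose_add, Matrix.conjTranspose_conjTranspose, add_comm]

theorem coeff_mem {W : Submodule ℂ H}
    (hW : ∀ (k : ℕ) (V : Matrix (Fin k) (Fin k) H), IsUnitaryRep V → IsIrreducible V →
      ∀ i j, V i j ∈ W) :
    ∀ (k : ℕ) {n : Type} [Fintype n] [DecidableEq n] (U : Matrix n n H), IsUnitaryRep U →
      Fintype.card n = k → ∀ i j, U i j ∈ W := by
  intro k
  induction k using Nat.strong_induction_on with
  | _ k ih =>
  intro n _ _ U hU hk i j
  by_cases hirr : IsIrreducible U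
  · let e := (Fintype.equivFin n).symm
    have hirr' : IsIrreducible (U.submatrix e e) := by
      refine ⟨⟨e.symm i⟩, fun S hS => ?_⟩
      have hS' : scal H S * U.submatrix e e = U.submatrix e e * scal H S := hS
      obtain ⟨c, hc⟩ := hirr.2 (S.submatrix e.symm e.symm) (by
        show scal H _ * U = U * scal H _
        have := congrArg (fun M => Matrix.submatrix M e.symm e.symm) hS'
        simp only [← Matrix.submatrix_mul_equiv _ _ _ e.symm] at this
        simpa [scal, Matrix.submatrix_map] using this)
      refine ⟨c, ?_⟩
      have := congrArg (fun M => Matrix.submatrix M e e) hc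
      simpa [Matrix.submatrix_smul] using this
    have := hW _ _ (hU.reindex e) hirr' (e.symm i) (e.symm j)
    simpa using this
  · have : ∃ S ∈ Mor U U, ∀ c : ℂ, S ≠ c • (1 : Matrix n n ℂ) := by
      by_contra hcon
      push Not at hcon
      exact hirr ⟨⟨i⟩, hcon⟩
    obtain ⟨S, hS, hs⟩ := this
    obtain ⟨T, hT, hTh, hTs⟩ := exists_hermitian hU.1 hS hs
    set V : Matrix n n ℂ := (hTh.eigenvectorUnitary : Matrix n n ℂ) with hVdef
    set D : Matrix n n ℂ := Matrix.diagonal (RCLike.ofReal ∘ hTh.eigenvalues) with hD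
    have hV1 : Vᴴ * V = 1 := (Unitary.mem_iff.1 hTh.eigenvectorUnitary.2).1
    have hV2 : V * Vᴴ = 1 := (Unitary.mem_iff.1 hTh.eigenvectorUnitary.2).2
    have hTD : T = V * D * Vᴴ := by
      have := hTh.spectral_theorem
      rwa [Unitary.conjStarAlgAut_apply] at this
    set U' : Matrix n n H := scal H Vᴴ * U * scal H V with hU'
    have hrep : IsUnitaryRep U' := hU.conj hV1 hV2
    have hV1' : scal H Vᴴ * scal H V = 1 := by rw [← scal_mul, hV1, scal_one]
    have hV2' : scal H V * scal H Vᴴ = 1 := by rw [← scal_mul, hV2, scal_one]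
    have hcomm : scal H D * U' = U' * scal H D := by
      have hT' : scal H T * U = U * scal H T := hT
      have hDT : D = Vᴴ * T * V := by
        rw [hTD]
        calc D = (Vᴴ * V) * D * (Vᴴ * V) := by rw [hV1, Matrix.one_mul, Matrix.mul_one]
          _ = _ := by simp only [Matrix.mul_assoc]
      rw [hDT, hU', scal_mul, scal_mul]
      calc _ = scal H Vᴴ * (scal H T * ((scal H V * scal H Vᴴ) * U)) * scal H V := by
            simp only [Matrix.mul_assoc]
        _ = scal H Vᴴ * (U * ((scal H V * scal H Vᴴ) * scal H T)) * scal H V := by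
            rw [hV2', Matrix.one_mul, Matrix.one_mul, hT']
        _ = _ := by simp only [Matrix.mul_assoc]
    have hzero : ∀ a b, hTh.eigenvalues a ≠ hTh.eigenvalues b → U' a b = 0 := by
      intro a b hab
      have h := congrFun (congrFun hcomm a) b
      have hsD : scal H D = Matrix.diagonal fun a => algebraMap ℂ H (hTh.eigenvalues a) := by
        rw [hD, scal, Matrix.diagonal_map (map_zero _)]; rfl
      rw [hsD, Matrix.diagonal_mul, Matrix.mul_diagonal, ← Algebra.commutes,
        ← sub_eq_zero, ← sub_mul, ← map_sub, ← Algebra.smul_def] at h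
      refine (smul_eq_zero.1 h).resolve_left ?_
      refine sub_ne_zero.2 ?_
      exact_mod_cast hab
    have hnon : ∃ a b, hTh.eigenvalues a ≠ hTh.eigenvalues b := by
      by_contra hcon
      push Not at hcon
      apply hTs (hTh.eigenvalues i)
      have : D = (hTh.eigenvalues i : ℂ) • (1 : Matrix n n ℂ) := by
        rw [hD, Matrix.smul_one_eq_diagonal]
        congr 1
        ext a
        simp [hcon a i]
      refine hTD.trans ?_
      rw [this, Matrix.mul_smul, Matrix.mul_one, Matrix.smul_mul, hV2]
    have hU'W : ∀ a b, U' a b ∈ W := by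
      intro a b
      by_cases hab : hTh.eigenvalues a = hTh.eigenvalues b
      · have hb := hrep.block (fun c => hTh.eigenvalues c = hTh.eigenvalues a)
          (fun c d hc hd => hzero c d (fun h => hd (h.symm.trans hc)))
          (fun c d hc hd => hzero c d (fun h => hc (h.trans hd)))
        have hlt : Fintype.card {c // hTh.eigenvalues c = hTh.eigenvalues a} < k := by
          rw [← hk]
          obtain ⟨c, d, hcd⟩ := hnon
          by_cases hc : hTh.eigenvalues c = hTh.eigenvalues a
          · exact Fintype.card_subtype_lt (x := d) (fun hd => hcd (hc.trans hd.symm))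
          · exact Fintype.card_subtype_lt (x := c) hc
        exact ih _ hlt _ hb rfl ⟨a, rfl⟩ ⟨b, hab.symm⟩
      · rw [hzero a b hab]; exact W.zero_mem
    have hUU' : U = scal H V * U' * scal H Vᴴ := by
      rw [hU']
      calc U = (scal H V * scal H Vᴴ) * U * (scal H V * scal H Vᴴ) := by
            rw [hV2', Matrix.one_mul, Matrix.mul_one]
        _ = _ := by simp only [Matrix.mul_assoc]
    rw [hUU']
    simp only [Matrix.mul_apply, scal, Matrix.map_apply, Finset.sum_mul]
    refine W.sum_mem fun a _ => W.sum_mem fun b _ => ?_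
    rw [← Algebra.commutes, ← Algebra.smul_def, ← Algebra.smul_def]
    exact W.smul_mem _ (W.smul_mem _ (hU'W _ _))



theorem IsUnitaryRep.counit_eq {n : Type*} [Fintype n] [DecidableEq n] {U : Matrix n n H}
    (hU : IsUnitaryRep U) (i j : n) :
    Coalgebra.counit (R := ℂ) (U i j) = (1 : Matrix n n ℂ) i j := by
  have hU2 : U * Uᴴ = 1 := (Unitary.mem_iff.1 hU.1).2
  have h : scal H (U.map (Coalgebra.counit (R := ℂ))) * U = U := by
    ext i j
    have h1 := Coalgebra.rTensor_counit_comul (R := ℂ) (U i j)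
    rw [hU.2] at h1
    have h2 := congrArg (TensorProduct.lid ℂ H) h1
    simp only [map_sum, LinearMap.rTensor_tmul, TensorProduct.lid_tmul, one_smul] at h2
    rw [← h2, Matrix.mul_apply]
    exact Finset.sum_congr rfl fun k _ => by
      rw [Algebra.smul_def]; rfl
  have h3 : scal H (U.map (Coalgebra.counit (R := ℂ))) = 1 := by
    have := congrArg (· * Uᴴ) h
    simpa only [Matrix.mul_assoc, hU2, Matrix.mul_one] using this
  have h4 := congrArg (Coalgebra.counit (R := ℂ)) (congrFun (congrFun h3 i) j)
  simp only [scal, Matrix.map_apply, Bialgebra.counit_algebraMap] at h4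
  rw [h4, Matrix.one_apply, Matrix.one_apply]
  split_ifs <;> simp

theorem IsUnitaryRep.antipode_eq {n : Type*} [Fintype n] [DecidableEq n] {U : Matrix n n H}
    (hU : IsUnitaryRep U) (i j : n) :
    HopfAlgebra.antipode ℂ (U i j) = star (U j i) := by
  have hU2 : U * Uᴴ = 1 := (Unitary.mem_iff.1 hU.1).2
  have h : U.map (HopfAlgebra.antipode ℂ) * U = 1 := by
    ext i j
    have h1 := HopfAlgebra.mul_antipode_rTensor_comul_apply (R := ℂ) (U i j)
    rw [hU.2, hU.counit_eq] at h1
    simp only [map_sum, LinearMap.rTensor_tmul, LinearMap.mul'_apply] at h1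
    rw [Matrix.mul_apply]
    simp only [Matrix.map_apply]
    rw [h1, Matrix.one_apply, Matrix.one_apply]
    split_ifs <;> simp
  have h3 : U.map (HopfAlgebra.antipode ℂ) = Uᴴ := by
    have := congrArg (· * Uᴴ) h
    simpa only [Matrix.mul_assoc, hU2, Matrix.mul_one, Matrix.one_mul] using this
  exact congrFun (congrFun h3 i) j

theorem triple_comm {n M : Type*} [Fintype n] [AddCommMonoid M] (f : n → n → n → M) :
    ∑ k, ∑ j, ∑ i, f k j i = ∑ i, ∑ j, ∑ k, f k j i := by
  rw [Finset.sum_comm, Finset.sum_congr rfl fun j _ => Finset.sum_comm, Finset.sum_comm]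

open scoped InnerProductSpace in
theorem coeff_independent {X : Type*} [Fintype X] [DecidableEq X] (n : X → ℕ)
    (U : ∀ x, Matrix (Fin (n x)) (Fin (n x)) H) (hU : ∀ x, IsUnitaryRep (U x))
    (hirr : ∀ x, ∀ S ∈ Mor (U x) (U x), ∃ c : ℂ, S = c • (1 : Matrix _ _ ℂ))
    (hne : ∀ x y, x ≠ y → ∀ S ∈ Mor (U x) (U y), S = 0)
    (c : (Σ x, Fin (n x) × Fin (n x)) → ℂ)
    (hc : ∑ p, c p • U p.1 p.2.1 p.2.2 = 0) : c = 0 := by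
  classical
  let L : EuclideanSpace ℂ (Σ x, Fin (n x) × Fin (n x)) →ₗ[ℂ] H :=
    { toFun := fun v => ∑ p, v p • U p.1 p.2.1 p.2.2
      map_add' := fun v w => by simp [add_smul, Finset.sum_add_distrib]
      map_smul' := fun a v => by simp [mul_smul, Finset.smul_sum] }
  have hL : ∀ v, L v = ∑ p, v p • U p.1 p.2.1 p.2.2 := fun v => rfl
  let R : Submodule ℂ (EuclideanSpace ℂ (Σ x, Fin (n x) × Fin (n x))) := LinearMap.ker L
  -- the action of functionals
  let A : (H →ₗ[ℂ] ℂ) → EuclideanSpace ℂ (Σ x, Fin (n x) × Fin (n x)) →ₗ[ℂ]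
      EuclideanSpace ℂ (Σ x, Fin (n x) × Fin (n x)) := fun φ =>
    { toFun := fun v => WithLp.toLp 2 fun p => ∑ i, φ (U p.1 i p.2.1) * v ⟨p.1, (i, p.2.2)⟩
      map_add' := fun v w => by
        ext p; simp [mul_add, Finset.sum_add_distrib]
      map_smul' := fun a v => by
        ext p; simp [Finset.mul_sum, mul_left_comm] }
  have hA : ∀ φ v p, A φ v p = ∑ i, φ (U p.1 i p.2.1) * v ⟨p.1, (i, p.2.2)⟩ := fun _ _ _ => rfl
  have hAR : ∀ φ, ∀ v ∈ R, A φ v ∈ R := by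
    intro φ v hv
    have hv' : L v = 0 := hv
    show L (A φ v) = 0
    have h1 := congrArg (fun t => TensorProduct.lid ℂ H (φ.rTensor H (Coalgebra.comul (R := ℂ) t)))
      hv'
    simp only [hL, map_sum, map_smul, (hU _).2, LinearMap.rTensor_tmul, TensorProduct.lid_tmul,
      map_zero] at h1
    rw [hL, ← h1, Fintype.sum_sigma, Fintype.sum_sigma]
    refine Finset.sum_congr rfl fun x _ => ?_
    rw [Fintype.sum_prod_type, Fintype.sum_prod_type]
    simp only [hA, Finset.sum_smul, Finset.smul_sum, smul_smul]
    rw [triple_comm]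
    refine Finset.sum_congr rfl fun i _ => Finset.sum_congr rfl fun j _ =>
      Finset.sum_congr rfl fun k _ => ?_
    rw [mul_comm]
  -- adjoints
  let adj : (H →ₗ[ℂ] ℂ) → (H →ₗ[ℂ] ℂ) := fun φ =>
    { toFun := fun a => star (φ (star (HopfAlgebra.antipode ℂ a)))
      map_add' := fun a b => by simp
      map_smul' := fun a b => by simp }
  have hadj : ∀ φ x i j, adj φ (U x i j) = star (φ (U x j i)) := by
    intro φ x i j
    show star (φ (star (HopfAlgebra.antipode ℂ (U x i j)))) = _
    rw [(hU x).antipode_eq, star_star]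
  have hAadj : ∀ φ v w, ⟪A (adj φ) v, w⟫_ℂ = ⟪v, A φ w⟫_ℂ := by
    intro φ v w
    simp only [PiLp.inner_apply, hA, hadj, RCLike.inner_apply]
    rw [Fintype.sum_sigma, Fintype.sum_sigma]
    refine Finset.sum_congr rfl fun x _ => ?_
    rw [Fintype.sum_prod_type, Fintype.sum_prod_type]
    simp only [map_sum, Finset.mul_sum, Finset.sum_mul, map_mul]
    rw [triple_comm]
    refine Finset.sum_congr rfl fun i _ => Finset.sum_congr rfl fun j _ =>
      Finset.sum_congr rfl fun k _ => ?_
    simp only [RCLike.star_def, RCLike.conj_conj]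
    ring
  let q : EuclideanSpace ℂ (Σ x, Fin (n x) × Fin (n x)) →L[ℂ]
      EuclideanSpace ℂ (Σ x, Fin (n x) × Fin (n x)) := R.starProjection
  have hqA : ∀ φ w, q (A φ w) = A φ (q w) := by
    intro φ w
    have hmem : A φ (q w) ∈ R := hAR φ _ (R.starProjection_apply_mem w)
    have horth : A φ w - A φ (q w) ∈ Rᗮ := by
      rw [← map_sub, Submodule.mem_orthogonal]
      intro r hr
      rw [← hAadj]
      exact (Submodule.sub_starProjection_mem_orthogonal w) _ (hAR _ _ hr)
    exact (Submodule.eq_starProjection_of_mem_orthogonal hmem horth)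
  let e : (Σ x, Fin (n x) × Fin (n x)) → EuclideanSpace ℂ (Σ x, Fin (n x) × Fin (n x)) := fun b => EuclideanSpace.single b 1
  have hmor : ∀ x y j m, (Matrix.of fun (l : Fin (n y)) (k : Fin (n x)) =>
      q (e ⟨y, (l, m)⟩) ⟨x, (k, j)⟩) ∈ Mor (U y) (U x) := by
    intro x y j m
    show scal H _ * U x = U y * scal H _
    ext l k
    rw [← sub_eq_zero]
    refine (Module.forall_dual_apply_eq_zero_iff ℂ _).1 fun φ => ?_
    have h1 := congrArg (fun v : EuclideanSpace ℂ (Σ x, Fin (n x) × Fin (n x)) => v ⟨x, (k, j)⟩) (hqA φ (e ⟨y, (l, m)⟩))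
    have hAe : A φ (e ⟨y, (l, m)⟩) = ∑ p, φ (U y l p) • e ⟨y, (p, m)⟩ := by
      ext ⟨z, p, s⟩
      rw [hA]
      simp only [e, WithLp.ofLp_sum, WithLp.ofLp_smul, Finset.sum_apply, Pi.smul_apply,
        PiLp.single_apply, smul_eq_mul]
      by_cases hz : z = y
      · subst hz
        by_cases hs : s = m
        · simp [hs]
        · simp [hs]
      · simp [hz]
    rw [hAe] at h1
    simp only [map_sum, map_smul, hA] at h1
    rw [map_sub, Matrix.mul_apply, Matrix.mul_apply, sub_eq_zero]
    simp only [scal, Matrix.map_apply, Matrix.of_apply, ← Algebra.commutes, ← Algebra.smul_def,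
      map_sum, map_smul]
    simp only [WithLp.ofLp_sum, WithLp.ofLp_smul, Finset.sum_apply, Pi.smul_apply,
      smul_eq_mul] at h1
    simp only [smul_eq_mul]
    refine (Finset.sum_congr rfl fun _ _ => mul_comm _ _).trans (h1.symm.trans ?_)
    exact Finset.sum_congr rfl fun _ _ => mul_comm _ _
  have htr : ∀ r ∈ R, ∑ x, ∑ k, r ⟨x, (k, k)⟩ = 0 := by
    intro r hr
    have h1 := congrArg (Coalgebra.counit (R := ℂ)) (show L r = 0 from hr)
    simp only [hL, map_sum, map_smul, (hU _).counit_eq, map_zero] at h1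
    rw [← h1, Fintype.sum_sigma]
    refine Finset.sum_congr rfl fun x _ => ?_
    rw [Fintype.sum_prod_type]
    simp [Matrix.one_apply]
  have hoff : ∀ x y k j l m, x ≠ y → q (e ⟨y, (l, m)⟩) ⟨x, (k, j)⟩ = 0 := by
    intro x y k j l m hxy
    exact congrFun (congrFun (hne y x hxy.symm _ (hmor x y j m)) l) k
  have hlam : ∀ x j m, ∃ a : ℂ, ∀ k l, q (e ⟨x, (l, m)⟩) ⟨x, (k, j)⟩ = if l = k then a else 0 := by
    intro x j m
    obtain ⟨a, ha⟩ := hirr x _ (hmor x x j m)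
    refine ⟨a, fun k l => ?_⟩
    have := congrFun (congrFun ha l) k
    simpa [Matrix.one_apply] using this
  have hdiag : ∀ x k m, q (e ⟨x, (k, m)⟩) ⟨x, (k, k)⟩ = 0 := by
    intro x k m
    have h0 : ∑ y, ∑ p, q (e ⟨x, (k, m)⟩) ⟨y, (p, p)⟩ = 0 :=
      htr _ (R.starProjection_apply_mem (e ⟨x, (k, m)⟩))
    rw [← h0]
    rw [Fintype.sum_eq_single x (fun y hy => Finset.sum_eq_zero fun p _ =>
      hoff y x p p k m hy)]
    symm
    refine Fintype.sum_eq_single k fun p hp => ?_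
    obtain ⟨a, ha⟩ := hlam x p m
    exact (ha p k).trans (if_neg hp.symm)
  have hq0 : ∀ b, q (e b) = 0 := by
    rintro ⟨y, l, m⟩
    ext ⟨x, k, j⟩
    by_cases hxy : x = y
    · subst hxy
      obtain ⟨a, ha⟩ := hlam x j m
      have ha0 : a = 0 := by
        rw [← hdiag x j m, ha, if_pos rfl]
      rw [ha, ha0]; simp
    · exact hoff _ _ _ _ _ _ hxy
  have hcR : WithLp.toLp 2 c ∈ R := hc
  have h1 : q (WithLp.toLp 2 c) = WithLp.toLp 2 c := Submodule.starProjection_eq_self_iff.2 hcR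
  have h2 : (WithLp.toLp 2 c : EuclideanSpace ℂ (Σ x, Fin (n x) × Fin (n x))) = ∑ b, c b • e b := by
    ext b
    simp [e, Pi.single_apply]
  have h3 : (WithLp.toLp 2 c : EuclideanSpace ℂ (Σ x, Fin (n x) × Fin (n x))) = 0 := by
    rw [← h1, h2, map_sum]
    exact Finset.sum_eq_zero fun b _ => by rw [map_smul, hq0, smul_zero]
  ext b
  exact congrArg (fun v : EuclideanSpace ℂ (Σ x, Fin (n x) × Fin (n x)) => v b) h3

/-! ### Equivalence classes of irreducible representations -/

variable (H) in
/-- Unitary equivalence of irreducible representations. -/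
instance irrepSetoid : Setoid (IrrepMatrix H) where
  r U V := ∃ S ∈ Mor U.mat V.mat, Sᴴ * S = 1 ∧ S * Sᴴ = 1
  iseqv :=
    { refl := fun U => ⟨1, by simp [Mor, scal_one], by simp, by simp⟩
      symm := by
        rintro U V ⟨S, hS, h1, h2⟩
        exact ⟨Sᴴ, mor_conjTranspose U.isUnitaryRep.1 V.isUnitaryRep.1 hS, by simpa using h2,
          by simpa using h1⟩
      trans := by
        rintro U V W ⟨S, hS, h1, h2⟩ ⟨T, hT, h3, h4⟩
        refine ⟨S * T, mor_mul hS hT, ?_, ?_⟩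
        · rw [Matrix.conjTranspose_mul, Matrix.mul_assoc, ← Matrix.mul_assoc Sᴴ, h1,
            Matrix.one_mul, h3]
        · rw [Matrix.conjTranspose_mul, Matrix.mul_assoc, ← Matrix.mul_assoc T, h4,
            Matrix.one_mul, h2] }

variable (H) in
/-- `Irred(𝔾)`, the set of equivalence classes of irreducible representations. -/
def Irred := Quotient (irrepSetoid H)

variable (H) in
/-- The trivial representation. -/
def trivialRep : IrrepMatrix H where
  dim := 1
  mat := 1
  isUnitaryRep := ⟨one_mem _, fun i j => by
    have hi : i = j := Subsingleton.elim i j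
    subst hi
    simp [Matrix.one_apply, Algebra.TensorProduct.one_def, Subsingleton.elim (0 : Fin 1) i]⟩
  isIrreducible := ⟨⟨0⟩, fun S _ => ⟨S 0 0, by
    ext i j
    rw [Subsingleton.elim i 0, Subsingleton.elim j 0]
    simp⟩⟩

variable (H) in
/-- The class `ε` of the trivial representation. -/
def Irred.eps : Irred H := Quotient.mk (irrepSetoid H) (trivialRep H)

variable (H) in
/-- A choice, for every `x ∈ Irred(𝔾)`, of a unitary representative `Uˣ = (u^x_{ij})` on
`H_x = ℂ^{dim x}` with its standard orthonormal basis `ξ^x_i`. -/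
structure Representatives where
  rep : Irred H → IrrepMatrix H
  rep_mk : ∀ x, Quotient.mk (irrepSetoid H) (rep x) = x

variable (H) in
instance : Nonempty (Representatives H) := ⟨⟨Quotient.out, Quotient.out_eq⟩⟩

namespace Representatives

variable (R : Representatives H)

/-- `dim H_x`. -/
abbrev dim (x : Irred H) : ℕ := (R.rep x).dim

/-- The chosen representative `Uˣ`; its entries are the matrix coefficients `u^x_{ij}`. -/
abbrev u (x : Irred H) : Matrix (Fin (R.dim x)) (Fin (R.dim x)) H := (R.rep x).mat

theorem u_rep (x : Irred H) : IsUnitaryRep (R.u x) := (R.rep x).isUnitaryRep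

theorem u_irr (x : Irred H) : IsIrreducible (R.u x) := (R.rep x).isIrreducible

/-- Schur: inequivalent irreducible representations have no intertwiners. -/
theorem mor_eq_zero {x y : Irred H} (hxy : x ≠ y) (S : Matrix (Fin (R.dim x)) (Fin (R.dim y)) ℂ)
    (hS : S ∈ Mor (R.u x) (R.u y)) : S = 0 := by
  by_contra hne
  have hS' := mor_conjTranspose (R.u_rep x).1 (R.u_rep y).1 hS
  obtain ⟨a, ha⟩ := (R.u_irr y).2 _ (mor_mul hS' hS)
  obtain ⟨b, hb⟩ := (R.u_irr x).2 _ (mor_mul hS hS')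
  have hab : a = b := by
    have h1 : (S * Sᴴ) * S = S * (Sᴴ * S) := Matrix.mul_assoc _ _ _
    rw [ha, hb, Matrix.smul_mul, Matrix.one_mul, Matrix.mul_smul, Matrix.mul_one] at h1
    have h2 : (b - a) • S = 0 := by rw [sub_smul, h1, sub_self]
    exact (sub_eq_zero.1 ((smul_eq_zero.1 h2).resolve_right hne)).symm
  obtain ⟨j⟩ := (R.u_irr y).1
  set r : ℝ := ∑ k, Complex.normSq (S k j) with hr
  have har : a = (r : ℂ) := by
    have := congrFun (congrFun ha j) j
    simp only [Matrix.mul_apply, Matrix.conjTranspose_apply, Matrix.smul_apply,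
      Matrix.one_apply_eq, smul_eq_mul, mul_one] at this
    rw [← this, hr]
    push_cast
    exact Finset.sum_congr rfl fun k _ => by rw [Complex.normSq_eq_conj_mul_self]; rfl
  have ha0 : a ≠ 0 := by
    rintro rfl
    rw [zero_smul] at ha
    open scoped ComplexOrder in
    exact hne (Matrix.conjTranspose_mul_self_eq_zero.1 ha)
  have hr0 : 0 < r := by
    refine lt_of_le_of_ne (Finset.sum_nonneg fun k _ => Complex.normSq_nonneg _) fun h => ha0 ?_
    rw [har, ← h]; simp
  let s : ℂ := ((Real.sqrt r)⁻¹ : ℝ)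
  have hs : star s * s * a = 1 := by
    have : star s = s := Complex.conj_ofReal _
    rw [this, har]
    simp only [s]
    rw [← Complex.ofReal_mul, ← Complex.ofReal_mul, ← mul_inv, Real.mul_self_sqrt hr0.le,
      inv_mul_cancel₀ hr0.ne', Complex.ofReal_one]
  apply hxy
  rw [← R.rep_mk x, ← R.rep_mk y]
  refine Quotient.sound ⟨s • S, ?_, ?_, ?_⟩
  · have h1 : scal H S * R.u y = R.u x * scal H S := hS
    have h2 : scal H (s • S) = s • scal H S := by
      ext i k
      simp only [scal, Matrix.map_apply, Matrix.smul_apply, smul_eq_mul, map_mul]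
      rw [Algebra.smul_def]
    show scal H (s • S) * R.u y = R.u x * scal H (s • S)
    rw [h2, Matrix.smul_mul, Matrix.mul_smul, h1]
  · rw [Matrix.conjTranspose_smul, Matrix.smul_mul, Matrix.mul_smul, smul_smul]
    exact (congrArg _ ha).trans (by rw [smul_smul, hs, one_smul])
  · rw [Matrix.conjTranspose_smul, Matrix.smul_mul, Matrix.mul_smul, smul_smul, mul_comm s]
    exact (congrArg _ hb).trans (by rw [smul_smul, ← hab, hs, one_smul])

theorem coeff_mem_of_equiv {U V : IrrepMatrix H} (h : (irrepSetoid H).r U V)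
    (i j : Fin V.dim) : V.mat i j ∈
      Submodule.span ℂ (Set.range fun p : Fin U.dim × Fin U.dim => U.mat p.1 p.2) := by
  obtain ⟨S, hS, h1, h2⟩ := h
  have hS' : scal H S * V.mat = U.mat * scal H S := hS
  have hV' : V.mat = scal H Sᴴ * U.mat * scal H S := by
    rw [Matrix.mul_assoc, ← hS', ← Matrix.mul_assoc, ← scal_mul, h1, scal_one, Matrix.one_mul]
  rw [hV']
  simp only [Matrix.mul_apply, scal, Matrix.map_apply, Finset.sum_mul]
  refine Submodule.sum_mem _ fun a _ => Submodule.sum_mem _ fun b _ => ?_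
  rw [← Algebra.commutes, ← Algebra.smul_def, ← Algebra.smul_def]
  exact Submodule.smul_mem _ _ (Submodule.smul_mem _ _ (Submodule.subset_span ⟨(b, a), rfl⟩))

theorem linearIndependent_coeff :
    LinearIndependent ℂ (fun p : (Σ x : Irred H, Fin (R.dim x) × Fin (R.dim x)) =>
      R.u p.1 p.2.1 p.2.2) := by
  classical
  rw [linearIndependent_iff']
  intro s g hg p hp
  let F : Finset (Irred H) := s.image Sigma.fst
  let c : (Σ x : F, Fin (R.dim x) × Fin (R.dim x)) → ℂ :=
    fun p => if (⟨p.1, p.2⟩ : Σ x : Irred H, Fin (R.dim x) × Fin (R.dim x)) ∈ s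
      then g ⟨p.1, p.2⟩ else 0
  have hc := coeff_independent (fun x : F => R.dim x) (fun x : F => R.u x) (fun x => R.u_rep x)
    (fun x => (R.u_irr x).2) (fun x y hxy => R.mor_eq_zero fun h => hxy (Subtype.ext h)) c (by
      rw [← hg]
      symm
      refine Finset.sum_of_injOn
        (fun q => if hq : q.1 ∈ F then (⟨⟨q.1, hq⟩, q.2⟩ : Σ x : F, Fin (R.dim x) × Fin (R.dim x))
          else ⟨⟨p.1, Finset.mem_image_of_mem _ hp⟩, p.2⟩) ?_ ?_ ?_ ?_
      · intro q hq q' hq' h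
        have h1 : q.1 ∈ F := Finset.mem_image_of_mem _ hq
        have h2 : q'.1 ∈ F := Finset.mem_image_of_mem _ hq'
        simp only [h1, h2, dif_pos] at h
        exact congrArg (fun t : (Σ x : F, Fin (R.dim x) × Fin (R.dim x)) =>
          (⟨t.1, t.2⟩ : Σ x : Irred H, Fin (R.dim x) × Fin (R.dim x))) h
      · intro q _; simp
      · rintro ⟨⟨x, hx⟩, q⟩ - hq
        have : (⟨x, q⟩ : Σ x : Irred H, Fin (R.dim x) × Fin (R.dim x)) ∉ s := by
          intro h
          exact hq ⟨⟨x, q⟩, h, by simp [hx]⟩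
        simp [c, this]
      · intro q hq
        have h1 : q.1 ∈ F := Finset.mem_image_of_mem _ hq
        have h2 : (if hq : q.1 ∈ F then (⟨⟨q.1, hq⟩, q.2⟩ : Σ x : F, Fin (R.dim x) × Fin (R.dim x))
          else ⟨⟨p.1, Finset.mem_image_of_mem _ hp⟩, p.2⟩) = ⟨⟨q.1, h1⟩, q.2⟩ := dif_pos h1
        rw [h2]
        simp only [c]
        rw [if_pos hq])
  have := congrFun hc ⟨⟨p.1, Finset.mem_image_of_mem _ hp⟩, p.2⟩
  simpa [c, hp] using this

theorem span_coeff [IsCompactQuantumGroup H] :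
    ⊤ ≤ Submodule.span ℂ (Set.range (fun p : (Σ x : Irred H, Fin (R.dim x) × Fin (R.dim x)) =>
      R.u p.1 p.2.1 p.2.2)) := by
  rw [← IsCompactQuantumGroup.span_coeff (H := H), Submodule.span_le]
  rintro _ ⟨n, U, hU, i, j, rfl⟩
  refine coeff_mem ?_ _ U hU rfl i j
  intro k V hV hirr i j
  exact Submodule.span_mono (by rintro _ ⟨p, rfl⟩; exact ⟨⟨_, p⟩, rfl⟩)
    (coeff_mem_of_equiv (Quotient.exact
      (R.rep_mk (Quotient.mk (irrepSetoid H) ⟨k, V, hV, hirr⟩))) i j)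

/-- The basis of `𝒪(𝔾)` consisting of the matrix coefficients `u^x_{ij}`. -/
noncomputable def basis [IsCompactQuantumGroup H] :
    Module.Basis (Σ x : Irred H, Fin (R.dim x) × Fin (R.dim x)) ℂ H :=
  Module.Basis.mk R.linearIndependent_coeff R.span_coeff

theorem basis_apply [IsCompactQuantumGroup H] (x : Irred H) (i j : Fin (R.dim x)) :
    R.basis ⟨x, (i, j)⟩ = R.u x i j := by
  simp [basis]

/-! ### The dual discrete quantum group -/

/-- For a family `a = (a^w)_w` of matrices over a vector space `M`, the linear map
`𝒪(𝔾) → M` with `u^w_{pq} ↦ a^w_{pq}`. -/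
noncomputable def pairing [IsCompactQuantumGroup H] {M : Type*} [AddCommGroup M] [Module ℂ M]
    (a : ∀ w, Matrix (Fin (R.dim w)) (Fin (R.dim w)) M) : H →ₗ[ℂ] M :=
  R.basis.constr ℂ fun p => a p.1 p.2.1 p.2.2

theorem pairing_u [IsCompactQuantumGroup H] {M : Type*} [AddCommGroup M] [Module ℂ M]
    (a : ∀ w, Matrix (Fin (R.dim w)) (Fin (R.dim w)) M) (x : Irred H) (i j : Fin (R.dim x)) :
    R.pairing a (R.u x i j) = a x i j := by
  rw [← basis_apply, pairing, Module.Basis.constr_basis]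

/-- The dual comultiplication `Δ̂`, applied to a family `a = (a^w)_w` in `∏_w B(H_w)` (possibly
with coefficients in a vector space `M`); the component of `Δ̂(a)` in `B(H_x ⊗ H_y)`.
It is determined by `(Δ̂ ⊗ id)(𝕍) = 𝕍₁₃ 𝕍₂₃` for `𝕍 = ⊕_w U^w`, that is, by writing the entries
`u^x_{ij} u^y_{kl}` of `U^x₁₃ U^y₂₃` in the basis `(u^w_{pq})` and replacing `u^w_{pq}` by
`a^w_{pq}`. -/
noncomputable def dualComul [IsCompactQuantumGroup H] {M : Type*} [AddCommGroup M] [Module ℂ M]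
    (a : ∀ w, Matrix (Fin (R.dim w)) (Fin (R.dim w)) M) (x y : Irred H) :
    Matrix (Fin (R.dim x) × Fin (R.dim y)) (Fin (R.dim x) × Fin (R.dim y)) M :=
  Matrix.of fun p q => R.pairing a (R.u x p.1 q.1 * R.u y p.2 q.2)

/-- `(Δ̂ ⊗ id)(𝕍) = 𝕍₁₃ 𝕍₂₃`. -/
theorem dualComul_fundamental [IsCompactQuantumGroup H] (x y : Irred H) :
    R.dualComul R.u x y = Matrix.of fun p q => R.u x p.1 q.1 * R.u y p.2 q.2 := by
  have : R.pairing R.u = LinearMap.id := R.basis.ext fun ⟨w, p, q⟩ => by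
    rw [basis_apply, pairing_u, LinearMap.id_apply]
  ext p q
  simp [dualComul, this]

/-- `Δ̂(a) T = T a` for every intertwiner `T ∈ Mor(x ⊗ y, w)`. -/
theorem dualComul_mul [IsCompactQuantumGroup H]
    (a : ∀ w, Matrix (Fin (R.dim w)) (Fin (R.dim w)) ℂ) (x y w : Irred H)
    (T : Matrix (Fin (R.dim x) × Fin (R.dim y)) (Fin (R.dim w)) ℂ)
    (hT : T ∈ Mor (Matrix.of fun p q => R.u x p.1 q.1 * R.u y p.2 q.2) (R.u w)) :
    R.dualComul a x y * T = T * a w := by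
  ext p q
  have h0 := congrFun (congrFun (show scal H T * R.u w = Matrix.of
    (fun p q : Fin (R.dim x) × Fin (R.dim y) => R.u x p.1 q.1 * R.u y p.2 q.2) * scal H T from hT)
    p) q
  rw [Matrix.mul_apply, Matrix.mul_apply] at h0
  have h := congrArg (R.pairing a) h0
  simp only [scal, Matrix.map_apply, ← Algebra.smul_def, map_sum, map_smul, pairing_u,
    Matrix.of_apply] at h
  simp only [← Algebra.commutes, ← Algebra.smul_def, map_smul, smul_eq_mul] at h
  rw [Matrix.mul_apply, Matrix.mul_apply, h]
  exact Finset.sum_congr rfl fun k _ => by rw [dualComul, Matrix.of_apply, mul_comm]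

/-- The `*`-algebra `∏_{x,y} B(H_x ⊗ H_y)`. Its bounded elements form the multiplier algebra
`ℳ(c₀(𝔾̂) ⊗ c₀(𝔾̂))`. -/
abbrev DualTwo : Type _ := ∀ x y : Irred H,
  Matrix (Fin (R.dim x) × Fin (R.dim y)) (Fin (R.dim x) × Fin (R.dim y)) ℂ

/-- Matrices acting on `H_x ⊗ H_y ⊗ H_z`. -/
abbrev DualThreeAt (x y z : Irred H) : Type :=
  Matrix (Fin (R.dim x) × Fin (R.dim y) × Fin (R.dim z))
    (Fin (R.dim x) × Fin (R.dim y) × Fin (R.dim z)) ℂ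

variable {R}

/-- Membership in `ℳ(c₀(𝔾̂) ⊗ c₀(𝔾̂))`: the operator norms of the components are bounded. -/
def IsMultiplier (Ω : R.DualTwo) : Prop :=
  ∃ C : ℝ, ∀ x y, ‖Matrix.toEuclideanCLM (𝕜 := ℂ) (Ω x y)‖ ≤ C

/-- `Ω ⊗ 1`. -/
def tensorOne (Ω : R.DualTwo) (x y z : Irred H) : R.DualThreeAt x y z :=
  Matrix.of fun p q => Ω x y (p.1, p.2.1) (q.1, q.2.1) * (1 : Matrix _ _ ℂ) p.2.2 q.2.2

/-- `1 ⊗ Ω`. -/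
def oneTensor (Ω : R.DualTwo) (x y z : Irred H) : R.DualThreeAt x y z :=
  Matrix.of fun p q => (1 : Matrix _ _ ℂ) p.1 q.1 * Ω y z p.2 q.2

/-- `(Δ̂ ⊗ id)(Ω)`. -/
noncomputable def comulTensorId [IsCompactQuantumGroup H] (Ω : R.DualTwo) (x y z : Irred H) :
    R.DualThreeAt x y z :=
  Matrix.of fun p q => R.dualComul (fun w => Matrix.of fun i j => Ω w z (i, p.2.2) (j, q.2.2)) x y
    (p.1, p.2.1) (q.1, q.2.1)

/-- `(id ⊗ Δ̂)(Ω)`. -/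
noncomputable def idTensorComul [IsCompactQuantumGroup H] (Ω : R.DualTwo) (x y z : Irred H) :
    R.DualThreeAt x y z :=
  Matrix.of fun p q => R.dualComul (fun w => Matrix.of fun i j => Ω x w (p.1, i) (q.1, j)) y z
    p.2 q.2

/-- `Ω` is a unitary 2-cocycle on `𝔾̂`. -/
structure IsUnitaryTwoCocycle [IsCompactQuantumGroup H] (Ω : R.DualTwo) : Prop where
  isMultiplier : IsMultiplier Ω
  unitary : Ω ∈ unitary R.DualTwo
  cocycle : ∀ x y z, tensorOne Ω x y z * comulTensorId Ω x y z =
    oneTensor Ω x y z * idTensorComul Ω x y z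

/-- `(p_ε ⊗ id) Ω = p_ε ⊗ id` and `(id ⊗ p_ε) Ω = id ⊗ p_ε`. -/
def IsNormalizedTwoCocycle (Ω : R.DualTwo) : Prop :=
  (∀ y, Ω (Irred.eps H) y = 1) ∧ ∀ x, Ω x (Irred.eps H) = 1

/-- The formula `σ(u^x_{ij} ⊗ u^y_{kl}) = ⟨ξ^x_i ⊗ ξ^y_k, Ω (ξ^x_j ⊗ ξ^y_l)⟩` for all indices. The
orthonormal basis vector `ξ^x_i ⊗ ξ^y_k` of `H_x ⊗ H_y` is the standard basis vector with
index `(i, k)`. -/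
def Corresponds (Ω : R.DualTwo) (σ : H ⊗[ℂ] H →ₗ[ℂ] ℂ) : Prop :=
  ∀ (x y : Irred H) (i j : Fin (R.dim x)) (k l : Fin (R.dim y)),
    σ (R.u x i j ⊗ₜ[ℂ] R.u y k l) =
      inner ℂ (EuclideanSpace.single (i, k) (1 : ℂ))
        (Matrix.toEuclideanCLM (𝕜 := ℂ) (Ω x y) (EuclideanSpace.single (j, l) (1 : ℂ)))

end Representatives

/-! ### Algebraic dual 2-cocycles on a Hopf `*`-algebra -/

/-- The convolution product
`(σ * τ)(a, b) = σ(a₍₁₎, b₍₁₎) τ(a₍₂₎, b₍₂₎)` of functionals on `H ⊗ H`. -/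
noncomputable def conv (σ τ : H ⊗[ℂ] H →ₗ[ℂ] ℂ) : H ⊗[ℂ] H →ₗ[ℂ] ℂ :=
  LinearMap.mul' ℂ ℂ ∘ₗ TensorProduct.map σ τ ∘ₗ Coalgebra.comul

/-- The dual 2-cocycle identity
`σ(a₍₁₎, b₍₁₎) σ(a₍₂₎ b₍₂₎, c) = σ(b₍₁₎, c₍₁₎) σ(a, b₍₂₎ c₍₂₎)`. The left-hand side is the
convolution of `σ` with `a ⊗ b ↦ σ(a b, c)`, at `a ⊗ b`; the right-hand side is the
convolution of `σ` with `b ⊗ c ↦ σ(a, b c)`, at `b ⊗ c`. -/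
def IsDualTwoCocycle (σ : H ⊗[ℂ] H →ₗ[ℂ] ℂ) : Prop :=
  ∀ a b c : H,
    conv σ (σ ∘ₗ (TensorProduct.mk ℂ H H).flip c ∘ₗ LinearMap.mul' ℂ H) (a ⊗ₜ[ℂ] b) =
      conv σ (σ ∘ₗ TensorProduct.mk ℂ H H a ∘ₗ LinearMap.mul' ℂ H) (b ⊗ₜ[ℂ] c)

/-- `σ` is normalized: `σ(1, h) = ε(h) = σ(h, 1)`. -/
def IsNormalizedDual (σ : H ⊗[ℂ] H →ₗ[ℂ] ℂ) : Prop :=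
  ∀ h : H, σ (1 ⊗ₜ[ℂ] h) = Coalgebra.counit (R := ℂ) h ∧
    σ (h ⊗ₜ[ℂ] 1) = Coalgebra.counit (R := ℂ) h

/-- `τ` is the convolution inverse of `σ`. -/
def IsConvInverse (σ τ : H ⊗[ℂ] H →ₗ[ℂ] ℂ) : Prop :=
  ∀ a b : H,
    conv σ τ (a ⊗ₜ[ℂ] b) = Coalgebra.counit (R := ℂ) a * Coalgebra.counit (R := ℂ) b ∧
    conv τ σ (a ⊗ₜ[ℂ] b) = Coalgebra.counit (R := ℂ) a * Coalgebra.counit (R := ℂ) b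

/-- `σ` is a unitary dual 2-cocycle: an invertible dual 2-cocycle such that
the complex conjugate of `σ(a, b)` is `σ⁻¹(S(a)^*, S(b)^*)`. -/
structure IsUnitaryDualTwoCocycle (σ : H ⊗[ℂ] H →ₗ[ℂ] ℂ) : Prop where
  cocycle : IsDualTwoCocycle σ
  unitary : ∃ τ : H ⊗[ℂ] H →ₗ[ℂ] ℂ, IsConvInverse σ τ ∧ ∀ a b : H,
    star (σ (a ⊗ₜ[ℂ] b)) =
      τ (star (HopfAlgebra.antipode ℂ a) ⊗ₜ[ℂ] star (HopfAlgebra.antipode ℂ b))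

end CQG

namespace CQG

variable {H : Type*} [Ring H] [StarRing H] [HopfAlgebra ℂ H] [StarModule ℂ H]

/-! The coefficients `u^x_{ij}` form a basis of `H`, so the products `u^x_{ij} ⊗ u^y_{kl}` form a
basis of `H ⊗ H`. A functional on `H ⊗ H` is therefore the same thing as an arbitrary family of
matrices in `∏ B(H_x ⊗ H_y)`; this is the bijection `dualEquiv`, and (1) says exactly that `Ω` and
`σ` match under it. Existence and uniqueness in both directions are then automatic, and what remains
is to translate each condition on `σ` into the corresponding condition on `Ω`.

Every translation rests on what the Hopf structure does to coefficients. Since `Δ(u_{ij}) = ∑ u_{ik}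
⊗ u_{kj}`, convolution becomes componentwise matrix multiplication (`dualEquiv_symm_conv`), with `ε
⊗ ε` as the identity. Since `S(u_{ij})^* = u_{ji}`, the condition on complex conjugates says that
the convolution inverse is the adjoint (`star_eq_iff`), so unitarity on the two sides agrees
(`unitary_iff`). Since `Δ̂` is defined by expanding products of coefficients in the basis, the
entries of the two sides of the cocycle equation for `Ω` are the two sides of the identity for `σ`
at coefficients, and trilinearity extends this to all of `H` (`isDualTwoCocycle_iff`). Normalization
matches because `u^ε` is the identity matrix. Boundedness of `Ω` costs nothing: unitary matrices
have norm at most one. -/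

theorem IsUnitaryRep.conv_apply {m n : Type*} [Fintype m] [Fintype n] [DecidableEq m]
    [DecidableEq n] {U : Matrix m m H} {V : Matrix n n H} (hU : IsUnitaryRep U)
    (hV : IsUnitaryRep V) (σ τ : H ⊗[ℂ] H →ₗ[ℂ] ℂ) (i j : m) (k l : n) :
    conv σ τ (U i j ⊗ₜ[ℂ] V k l) =
      ∑ r, ∑ s, σ (U i r ⊗ₜ[ℂ] V k s) * τ (U r j ⊗ₜ[ℂ] V s l) := by
  simp [conv, TensorProduct.comul_tmul, hU.2, hV.2, TensorProduct.sum_tmul,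
    TensorProduct.tmul_sum]
  exact Finset.sum_comm

namespace Representatives

variable {R : Representatives H}

/-! ### Matrix entries and the trivial representation -/

theorem corresponds_iff {Ω : R.DualTwo} {σ : H ⊗[ℂ] H →ₗ[ℂ] ℂ} :
    Corresponds Ω σ ↔ ∀ x y p q, σ (R.u x p.1 q.1 ⊗ₜ[ℂ] R.u y p.2 q.2) = Ω x y p q := by
  have key : ∀ x y (p q : Fin (R.dim x) × Fin (R.dim y)),
      inner ℂ (EuclideanSpace.single p (1 : ℂ))
        (Matrix.toEuclideanCLM (𝕜 := ℂ) (Ω x y) (EuclideanSpace.single q (1 : ℂ))) =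
      Ω x y p q := by
    intro x y p q
    simp [EuclideanSpace.inner_single_left]
  unfold Corresponds
  simp only [key, Prod.forall]
  exact ⟨fun h x y i k j l => h x y i j k l, fun h x y i j k l => h x y i k j l⟩

/-- The chosen representative of the class `ε` is only unitarily equivalent to the `1 × 1` identity,
through some `S`. But `S = u S` and `S Sᴴ = 1` force `u = 1`: conjugating an identity matrix gives
an identity matrix. -/
theorem trivial_u (i j : Fin (R.dim (Irred.eps H))) :
    R.u (Irred.eps H) i j = (1 : Matrix _ _ H) i j := by
  obtain ⟨S, hS, -, h2⟩ := Quotient.exact (R.rep_mk (Irred.eps H))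
  have hS' : scal H S = R.u (Irred.eps H) * scal H S := by
    have : scal H S * (1 : Matrix _ _ H) = R.u (Irred.eps H) * scal H S := hS
    rwa [show scal H S * (1 : Matrix _ _ H) = scal H S from Matrix.mul_one _] at this
  have h := congrArg (· * scal H Sᴴ) hS'
  simp only [Matrix.mul_assoc, ← scal_mul, h2, scal_one, Matrix.mul_one] at h
  rw [← h]

variable [IsCompactQuantumGroup H]

/-! ### Functionals on `H ⊗ H` as families of matrices -/

theorem ext_u {M : Type*} [AddCommMonoid M] [Module ℂ M] {σ τ : H ⊗[ℂ] H →ₗ[ℂ] M}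
    (h : ∀ x y i j k l, σ (R.u x i j ⊗ₜ[ℂ] R.u y k l) = τ (R.u x i j ⊗ₜ[ℂ] R.u y k l)) :
    σ = τ := by
  refine (R.basis.tensorProduct R.basis).ext ?_
  rintro ⟨⟨x, i, j⟩, ⟨y, k, l⟩⟩
  simpa [Module.Basis.tensorProduct_apply, basis_apply] using h x y i j k l

variable (R) in
/-- Families of matrices in `∏_{x,y} B(H_x ⊗ H_y)` are the same as functionals on `H ⊗ H`, through
`σ(u^x_{ij} ⊗ u^y_{kl}) = Ω_{xy}((i, k), (j, l))`. -/
noncomputable def dualEquiv : R.DualTwo ≃ (H ⊗[ℂ] H →ₗ[ℂ] ℂ) where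
  toFun Ω := (R.basis.tensorProduct R.basis).constr ℂ fun p =>
    Ω p.1.1 p.2.1 (p.1.2.1, p.2.2.1) (p.1.2.2, p.2.2.2)
  invFun σ x y := Matrix.of fun p q => σ (R.u x p.1 q.1 ⊗ₜ[ℂ] R.u y p.2 q.2)
  left_inv Ω := by
    funext x y
    ext p q
    change (R.basis.tensorProduct R.basis).constr ℂ _ (R.u x p.1 q.1 ⊗ₜ[ℂ] R.u y p.2 q.2) = _
    rw [← basis_apply, ← basis_apply, ← Module.Basis.tensorProduct_apply,
      Module.Basis.constr_basis]
  right_inv σ := ext_u (R := R) fun x y i j k l => by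
    rw [← basis_apply, ← basis_apply, ← Module.Basis.tensorProduct_apply,
      Module.Basis.constr_basis, Module.Basis.tensorProduct_apply, basis_apply, basis_apply]
    rfl

theorem dualEquiv_symm_apply (σ : H ⊗[ℂ] H →ₗ[ℂ] ℂ) (x y : Irred H)
    (p q : Fin (R.dim x) × Fin (R.dim y)) :
    R.dualEquiv.symm σ x y p q = σ (R.u x p.1 q.1 ⊗ₜ[ℂ] R.u y p.2 q.2) := rfl

/-- This form turns existence and uniqueness, for `σ` given `Ω` and for `Ω` given `σ`, into the
bijectivity of `dualEquiv`. -/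
theorem corresponds_iff_eq {Ω : R.DualTwo} {σ : H ⊗[ℂ] H →ₗ[ℂ] ℂ} :
    Corresponds Ω σ ↔ Ω = R.dualEquiv.symm σ := by
  rw [corresponds_iff]
  refine ⟨fun h => ?_, ?_⟩
  · funext x y
    ext p q
    exact (h x y p q).symm
  · rintro rfl x y p q
    rfl

/-! ### Convolution as matrix multiplication -/

theorem dualEquiv_symm_conv (σ τ : H ⊗[ℂ] H →ₗ[ℂ] ℂ) :
    R.dualEquiv.symm (conv σ τ) = R.dualEquiv.symm σ * R.dualEquiv.symm τ := by
  funext x y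
  ext p q
  rw [dualEquiv_symm_apply, (R.u_rep x).conv_apply (R.u_rep y), Pi.mul_apply, Pi.mul_apply,
    Matrix.mul_apply, Fintype.sum_prod_type]
  rfl

variable (H) in
/-- The unit `ε ⊗ ε` of the convolution algebra. -/
noncomputable def counitTwo : H ⊗[ℂ] H →ₗ[ℂ] ℂ :=
  LinearMap.mul' ℂ ℂ ∘ₗ TensorProduct.map Coalgebra.counit Coalgebra.counit

theorem dualEquiv_symm_counitTwo : R.dualEquiv.symm (counitTwo H) = 1 := by
  funext x y
  ext p q
  simp only [dualEquiv_symm_apply, counitTwo, LinearMap.comp_apply, TensorProduct.map_tmul,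
    LinearMap.mul'_apply, (R.u_rep x).counit_eq, (R.u_rep y).counit_eq, Pi.one_apply,
    Matrix.one_apply, Prod.ext_iff, ite_and]
  split_ifs <;> simp

/-- Convolution and its unit `ε ⊗ ε` correspond to the product and unit of `∏ B(H_x ⊗ H_y)`, so
convolution inverses are inverses in that ring. -/
theorem isConvInverse_iff {σ τ : H ⊗[ℂ] H →ₗ[ℂ] ℂ} : IsConvInverse σ τ ↔
    R.dualEquiv.symm σ * R.dualEquiv.symm τ = 1 ∧
      R.dualEquiv.symm τ * R.dualEquiv.symm σ = 1 := by
  have key : ∀ φ ψ : H ⊗[ℂ] H →ₗ[ℂ] ℂ, R.dualEquiv.symm φ * R.dualEquiv.symm ψ = 1 ↔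
      ∀ a b, conv φ ψ (a ⊗ₜ[ℂ] b) =
        Coalgebra.counit (R := ℂ) a * Coalgebra.counit (R := ℂ) b := by
    intro φ ψ
    rw [← dualEquiv_symm_conv, ← dualEquiv_symm_counitTwo, R.dualEquiv.symm.injective.eq_iff]
    exact ⟨fun h a b => by rw [h]; rfl, fun h => TensorProduct.ext' h⟩
  rw [key, key]
  simp only [IsConvInverse, forall_and]

/-- Serves identities that are conjugate-linear in `a`, where comparing linear maps on a basis does
not apply directly. -/
theorem induction_u {motive : H → Prop} (R : Representatives H) (a : H) (zero : motive 0)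
    (add : ∀ a b, motive a → motive b → motive (a + b))
    (smul : ∀ (c : ℂ) a, motive a → motive (c • a))
    (basis : ∀ x i j, motive (R.u x i j)) : motive a := by
  refine Submodule.span_induction (p := fun a _ => motive a) ?_ zero
    (fun a b _ _ => add a b) (fun c a _ => smul c a) (R.span_coeff (Submodule.mem_top (x := a)))
  rintro _ ⟨p, rfl⟩
  exact basis _ _ _

/-! ### Unitarity and boundedness -/

/-- On coefficients `S(u_{ij})^* = u_{ji}`, so the first condition conjugates entries and swaps row
and column indices: it is the conjugate transpose. Both of its sides are conjugate-linear in `a` and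
in `b`, so coefficients suffice. -/
theorem star_eq_iff {σ τ : H ⊗[ℂ] H →ₗ[ℂ] ℂ} :
    (∀ a b : H, star (σ (a ⊗ₜ[ℂ] b)) =
      τ (star (HopfAlgebra.antipode ℂ a) ⊗ₜ[ℂ] star (HopfAlgebra.antipode ℂ b))) ↔
    R.dualEquiv.symm τ = star (R.dualEquiv.symm σ) := by
  constructor
  · intro h
    funext x y
    ext p q
    have := h (R.u x q.1 p.1) (R.u y q.2 p.2)
    rw [(R.u_rep x).antipode_eq, (R.u_rep y).antipode_eq, star_star, star_star] at this
    exact this.symm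
  · intro h a b
    have key : ∀ x y i j k l, star (σ (R.u x i j ⊗ₜ[ℂ] R.u y k l)) =
        τ (R.u x j i ⊗ₜ[ℂ] R.u y l k) := fun x y i j k l =>
      (congrFun (congrFun (congrFun (congrFun h x) y) (j, l)) (i, k)).symm
    refine R.induction_u (motive := fun a => star (σ (a ⊗ₜ[ℂ] b)) =
      τ (star (HopfAlgebra.antipode ℂ a) ⊗ₜ[ℂ] star (HopfAlgebra.antipode ℂ b))) a
      (by simp) (fun a a' ha ha' => by simp [TensorProduct.add_tmul, ha, ha'])
      (fun c a ha => by simp [← TensorProduct.smul_tmul', ha]) fun x i j => ?_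
    refine R.induction_u (motive := fun b => star (σ (R.u x i j ⊗ₜ[ℂ] b)) =
      τ (star (HopfAlgebra.antipode ℂ (R.u x i j)) ⊗ₜ[ℂ] star (HopfAlgebra.antipode ℂ b))) b
      (by simp) (fun b b' hb hb' => by simp [TensorProduct.tmul_add, hb, hb'])
      (fun c b hb => by simp [TensorProduct.tmul_smul, hb]) fun y k l => ?_
    rw [(R.u_rep x).antipode_eq, (R.u_rep y).antipode_eq, star_star, star_star, key]

theorem unitary_iff {σ : H ⊗[ℂ] H →ₗ[ℂ] ℂ} :
    (∃ τ : H ⊗[ℂ] H →ₗ[ℂ] ℂ, IsConvInverse σ τ ∧ ∀ a b : H,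
      star (σ (a ⊗ₜ[ℂ] b)) =
        τ (star (HopfAlgebra.antipode ℂ a) ⊗ₜ[ℂ] star (HopfAlgebra.antipode ℂ b))) ↔
    R.dualEquiv.symm σ ∈ unitary R.DualTwo := by
  simp only [isConvInverse_iff (R := R), star_eq_iff (R := R), Unitary.mem_iff]
  constructor
  · rintro ⟨τ, ⟨h1, h2⟩, h⟩
    rw [← h]
    exact ⟨h2, h1⟩
  · rintro ⟨h1, h2⟩
    -- The inverse of a unitary is its adjoint, which dictates `τ`.
    refine ⟨R.dualEquiv (star (R.dualEquiv.symm σ)), ?_, ?_⟩ <;>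
      simp [h1, h2]

theorem isMultiplier_of_mem_unitary {Ω : R.DualTwo} (h : Ω ∈ unitary R.DualTwo) :
    IsMultiplier Ω := by
  refine ⟨1, fun x y => ?_⟩
  have hU : Matrix.toEuclideanCLM (𝕜 := ℂ) (Ω x y) ∈ unitary _ :=
    Unitary.map_mem (Matrix.toEuclideanCLM (𝕜 := ℂ)) (r := Ω x y) (Unitary.mem_iff.2
      ⟨congrFun (congrFun (Unitary.mem_iff.1 h).1 x) y,
        congrFun (congrFun (Unitary.mem_iff.1 h).2 x) y⟩)
  -- A unitary has norm exactly one only in a nontrivial algebra; in the zero algebra the norm is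
  -- `0`, and the bound still holds.
  rcases subsingleton_or_nontrivial (EuclideanSpace ℂ (Fin (R.dim x) × Fin (R.dim y)) →L[ℂ]
    EuclideanSpace ℂ (Fin (R.dim x) × Fin (R.dim y))) with _ | _
  · rw [norm_of_subsingleton]
    exact zero_le_one
  · exact (CStarRing.norm_of_mem_unitary hU).le

/-! ### The cocycle identity -/

/-- Identifies the functional hidden in `Δ̂ ⊗ id`: evaluated on `u^x_{ij} u^y_{i'j'}`, it makes the
entries of `(Δ̂ ⊗ id)(Ω)` the numbers `σ(u^x_{ij} u^y_{i'j'}, u^z_{kl})`. -/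
theorem pairing_left (σ : H ⊗[ℂ] H →ₗ[ℂ] ℂ) (z : Irred H) (k l : Fin (R.dim z)) :
    R.pairing (fun w => Matrix.of fun i j => R.dualEquiv.symm σ w z (i, k) (j, l)) =
      σ ∘ₗ (TensorProduct.mk ℂ H H).flip (R.u z k l) :=
  R.basis.ext fun ⟨w, i, j⟩ => by rw [basis_apply, pairing_u]; rfl

theorem pairing_right (σ : H ⊗[ℂ] H →ₗ[ℂ] ℂ) (x : Irred H) (i j : Fin (R.dim x)) :
    R.pairing (fun w => Matrix.of fun k l => R.dualEquiv.symm σ x w (i, k) (j, l)) =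
      σ ∘ₗ TensorProduct.mk ℂ H H (R.u x i j) :=
  R.basis.ext fun ⟨w, k, l⟩ => by rw [basis_apply, pairing_u]; rfl

theorem tensorOne_mul_comulTensorId (σ : H ⊗[ℂ] H →ₗ[ℂ] ℂ) (x y z : Irred H)
    (p q : Fin (R.dim x) × Fin (R.dim y) × Fin (R.dim z)) :
    (tensorOne (R.dualEquiv.symm σ) x y z * comulTensorId (R.dualEquiv.symm σ) x y z) p q =
      conv σ (σ ∘ₗ (TensorProduct.mk ℂ H H).flip (R.u z p.2.2 q.2.2) ∘ₗ LinearMap.mul' ℂ H)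
        (R.u x p.1 q.1 ⊗ₜ[ℂ] R.u y p.2.1 q.2.1) := by
  rw [(R.u_rep x).conv_apply (R.u_rep y), Matrix.mul_apply, Fintype.sum_prod_type]
  refine Finset.sum_congr rfl fun r _ => ?_
  rw [Fintype.sum_prod_type]
  refine Finset.sum_congr rfl fun s _ => ?_
  -- The identity on the third leg of `Ω ⊗ 1` leaves a single term, so only the sums over the first
  -- two legs survive; these are the sums in the convolution.
  rw [Fintype.sum_eq_single p.2.2 fun t ht => by
    simp [tensorOne, Matrix.one_apply_ne ht.symm]]
  simp only [tensorOne, comulTensorId, dualComul, Matrix.of_apply, pairing_left,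
    Matrix.one_apply_eq, mul_one]
  rfl

theorem oneTensor_mul_idTensorComul (σ : H ⊗[ℂ] H →ₗ[ℂ] ℂ) (x y z : Irred H)
    (p q : Fin (R.dim x) × Fin (R.dim y) × Fin (R.dim z)) :
    (oneTensor (R.dualEquiv.symm σ) x y z * idTensorComul (R.dualEquiv.symm σ) x y z) p q =
      conv σ (σ ∘ₗ TensorProduct.mk ℂ H H (R.u x p.1 q.1) ∘ₗ LinearMap.mul' ℂ H)
        (R.u y p.2.1 q.2.1 ⊗ₜ[ℂ] R.u z p.2.2 q.2.2) := by
  -- Here the first leg collapses, because `1 ⊗ Ω` acts there as the identity.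
  rw [(R.u_rep y).conv_apply (R.u_rep z), Matrix.mul_apply, Fintype.sum_prod_type,
    Fintype.sum_eq_single p.1 fun t ht => Finset.sum_eq_zero fun r _ => by
      simp [oneTensor, Matrix.one_apply_ne ht.symm], Fintype.sum_prod_type]
  refine Finset.sum_congr rfl fun r _ => Finset.sum_congr rfl fun s _ => ?_
  simp only [oneTensor, idTensorComul, dualComul, Matrix.of_apply, pairing_right,
    Matrix.one_apply_eq, one_mul]
  rfl

theorem conv_add_right (σ τ τ' : H ⊗[ℂ] H →ₗ[ℂ] ℂ) :
    conv σ (τ + τ') = conv σ τ + conv σ τ' := by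
  simp [conv, TensorProduct.map_add_right, LinearMap.comp_add, LinearMap.add_comp]

theorem conv_smul_right (c : ℂ) (σ τ : H ⊗[ℂ] H →ₗ[ℂ] ℂ) :
    conv σ (c • τ) = c • conv σ τ := by
  simp [conv, TensorProduct.map_smul_right, LinearMap.comp_smul, LinearMap.smul_comp]

/-- Convolution, as a linear map in its second argument. -/
noncomputable def convLinear (σ : H ⊗[ℂ] H →ₗ[ℂ] ℂ) :
    (H ⊗[ℂ] H →ₗ[ℂ] ℂ) →ₗ[ℂ] (H ⊗[ℂ] H →ₗ[ℂ] ℂ) where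
  toFun := conv σ
  map_add' := conv_add_right σ
  map_smul' c := conv_smul_right c σ

/-- The matrix equation is the dual cocycle identity evaluated at triples of coefficients. Both
sides of that identity are trilinear in `(a, b, c)`, so such triples decide it. -/
theorem isDualTwoCocycle_iff {σ : H ⊗[ℂ] H →ₗ[ℂ] ℂ} : IsDualTwoCocycle σ ↔
    ∀ x y z, tensorOne (R.dualEquiv.symm σ) x y z * comulTensorId (R.dualEquiv.symm σ) x y z =
      oneTensor (R.dualEquiv.symm σ) x y z * idTensorComul (R.dualEquiv.symm σ) x y z := by
  constructor
  · intro h x y z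
    ext p q
    rw [tensorOne_mul_comulTensorId, oneTensor_mul_idTensorComul]
    exact h _ _ _
  · intro h
    -- `F c` at `a ⊗ b` and `G a` at `b ⊗ c` are the two sides of the identity. Flipping and
    -- currying puts both in the form `a ↦ b ↦ c ↦ _`, where basis extensionality applies three
    -- times.
    let F : H →ₗ[ℂ] (H ⊗[ℂ] H →ₗ[ℂ] ℂ) := convLinear σ ∘ₗ
      LinearMap.lcomp ℂ ℂ (LinearMap.mul' ℂ H) ∘ₗ (TensorProduct.curry σ).flip
    let G : H →ₗ[ℂ] (H ⊗[ℂ] H →ₗ[ℂ] ℂ) := convLinear σ ∘ₗ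
      LinearMap.lcomp ℂ ℂ (LinearMap.mul' ℂ H) ∘ₗ TensorProduct.curry σ
    have hFG : TensorProduct.curry F.flip = TensorProduct.lcurry (.id ℂ) H H ℂ ∘ₗ G := by
      refine R.basis.ext fun ⟨x, i, j⟩ => R.basis.ext fun ⟨y, k, l⟩ =>
        R.basis.ext fun ⟨z, m, n⟩ => ?_
      have := congrFun (congrFun (h x y z) (i, k, m)) (j, l, n)
      rw [tensorOne_mul_comulTensorId, oneTensor_mul_idTensorComul] at this
      simp only [basis_apply]
      exact this
    exact fun a b c => LinearMap.congr_fun (LinearMap.congr_fun (LinearMap.congr_fun hFG a) b) c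

/-- Boundedness has no counterpart on the side of `σ`; it is recovered from unitarity. -/
theorem isUnitaryTwoCocycle_iff {σ : H ⊗[ℂ] H →ₗ[ℂ] ℂ} :
    IsUnitaryTwoCocycle (R.dualEquiv.symm σ) ↔ IsUnitaryDualTwoCocycle σ :=
  ⟨fun h => ⟨isDualTwoCocycle_iff.2 h.cocycle, unitary_iff.2 h.unitary⟩, fun h =>
    ⟨isMultiplier_of_mem_unitary (unitary_iff.1 h.unitary), unitary_iff.1 h.unitary,
      isDualTwoCocycle_iff.1 h.cocycle⟩⟩

/-! ### Normalization -/

theorem isNormalizedTwoCocycle_iff {σ : H ⊗[ℂ] H →ₗ[ℂ] ℂ} :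
    IsNormalizedTwoCocycle (R.dualEquiv.symm σ) ↔ IsNormalizedDual σ := by
  constructor
  · rintro ⟨h1, h2⟩
    -- Irreducible representations are nonzero, so `u^ε` has a diagonal entry; it equals `1` and
    -- realizes the unit of `H` as a coefficient.
    obtain ⟨i⟩ := (R.u_irr (Irred.eps H)).1
    have hi : R.u (Irred.eps H) i i = 1 := by rw [trivial_u, Matrix.one_apply_eq]
    have e1 : σ ∘ₗ TensorProduct.mk ℂ H H 1 = Coalgebra.counit := R.basis.ext fun ⟨y, k, l⟩ => by
      have := congrFun (congrFun (h1 y) (i, k)) (i, l)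
      rw [dualEquiv_symm_apply, hi] at this
      rw [basis_apply, (R.u_rep y).counit_eq]
      simpa [Matrix.one_apply] using this
    have e2 : σ ∘ₗ (TensorProduct.mk ℂ H H).flip 1 = Coalgebra.counit :=
      R.basis.ext fun ⟨y, k, l⟩ => by
      have := congrFun (congrFun (h2 y) (k, i)) (l, i)
      rw [dualEquiv_symm_apply, hi] at this
      rw [basis_apply, (R.u_rep y).counit_eq]
      simpa [Matrix.one_apply] using this
    exact fun h => ⟨LinearMap.congr_fun e1 h, LinearMap.congr_fun e2 h⟩
  · intro h
    refine ⟨fun y => ?_, fun x => ?_⟩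
    · ext p q
      rw [dualEquiv_symm_apply, trivial_u]
      -- On the diagonal of `u^ε` the claim is `σ(1, u^y_{kl}) = ε(u^y_{kl})`; off it both sides
      -- vanish.
      by_cases hp : p.1 = q.1
      · simp [Matrix.one_apply, hp, (h _).1, (R.u_rep y).counit_eq, Prod.ext_iff]
      · simp [hp, Prod.ext_iff]
    · ext p q
      rw [dualEquiv_symm_apply, trivial_u]
      by_cases hp : p.2 = q.2
      · simp [Matrix.one_apply, hp, (h _).2, (R.u_rep x).counit_eq, Prod.ext_iff]
      · simp [hp, Prod.ext_iff]

end Representatives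

end CQG
-- The correspondence of 2-cocycles
theorem mainTheorem9 {H : Type*} [Ring H] [StarRing H] [HopfAlgebra ℂ H] [StarModule ℂ H]
    [CQG.IsCompactQuantumGroup H] (R : CQG.Representatives H) :
    (∀ Ω : R.DualTwo, CQG.Representatives.IsUnitaryTwoCocycle Ω →
      (∃! σ : H ⊗[ℂ] H →ₗ[ℂ] ℂ, CQG.Representatives.Corresponds Ω σ) ∧
      ∀ σ : H ⊗[ℂ] H →ₗ[ℂ] ℂ, CQG.Representatives.Corresponds Ω σ →
        CQG.IsUnitaryDualTwoCocycle σ ∧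
        (CQG.Representatives.IsNormalizedTwoCocycle Ω → CQG.IsNormalizedDual σ)) ∧
    (∀ σ : H ⊗[ℂ] H →ₗ[ℂ] ℂ, CQG.IsUnitaryDualTwoCocycle σ →
      (∃! Ω : R.DualTwo, CQG.Representatives.Corresponds Ω σ) ∧
      ∀ Ω : R.DualTwo, CQG.Representatives.Corresponds Ω σ →
        CQG.Representatives.IsUnitaryTwoCocycle Ω ∧
        (CQG.IsNormalizedDual σ → CQG.Representatives.IsNormalizedTwoCocycle Ω)) ∧
    ∃ e : {Ω : R.DualTwo // CQG.Representatives.IsUnitaryTwoCocycle Ω ∧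
          CQG.Representatives.IsNormalizedTwoCocycle Ω} ≃
        {σ : H ⊗[ℂ] H →ₗ[ℂ] ℂ // CQG.IsUnitaryDualTwoCocycle σ ∧ CQG.IsNormalizedDual σ},
      ∀ Ω, CQG.Representatives.Corresponds Ω.1 (e Ω).1 := by

  simp only [CQG.Representatives.corresponds_iff_eq, forall_eq]
  refine ⟨fun Ω hΩ => ?_, fun σ hσ => ⟨⟨_, rfl, fun _ h => h⟩,
    CQG.Representatives.isUnitaryTwoCocycle_iff.2 hσ,
    CQG.Representatives.isNormalizedTwoCocycle_iff.2⟩, ?_⟩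
  -- Surjectivity provides `σ`, and injectivity makes it the only functional satisfying (1).
  · obtain ⟨σ, rfl⟩ := R.dualEquiv.symm.surjective Ω
    refine ⟨⟨σ, rfl, fun τ h => R.dualEquiv.symm.injective h.symm⟩, fun τ h => ?_⟩
    obtain rfl := R.dualEquiv.symm.injective h
    exact ⟨CQG.Representatives.isUnitaryTwoCocycle_iff.1 hΩ,
      CQG.Representatives.isNormalizedTwoCocycle_iff.1⟩
  -- The bijection in (c) is `dualEquiv` itself, restricted to the normalized unitary cocycles on
  -- each side.
  · refine ⟨R.dualEquiv.subtypeEquiv fun Ω => ?_, fun Ω => ?_⟩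
    · rw [← CQG.Representatives.isUnitaryTwoCocycle_iff (R := R),
        ← CQG.Representatives.isNormalizedTwoCocycle_iff (R := R), Equiv.symm_apply_apply]
    · exact (R.dualEquiv.symm_apply_apply Ω.1).symm
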